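/- Let $\mathcal S,\mathcal A$ be finite sets, $\mathcal P(s'|s,a)$ transition probabilities, $r(s,a,s')$ rewards with $|r(s,a,s')|\le r_{\max}$ for all $s,a,s'$, and $\mu(s,a)$ a stationary randomized policy. Suppose that the transition matrix $P(s,s')=\sum_a\mu(s,a)\mathcal P(s'|s,a)$ is irreducible and aperiodic, let $\pi$ be its stationary distribution, and suppose that there are constants $m>0$, $\rho\in(0,1)$ with $\sup_{s}d_{\rm TV}(P^t(s,\cdot),\pi)\le m\rho^t$ for all integers $t\ge 0$. Let $\tau^{\rm mix}(\epsilon)=\min\{t\in\mathbb N: t\ge 1,\ m\rho^t\le\epsilon\}$. For $V:\mathcal S\to\mathbb R$ put $$\|V\|_D^2=\sum_s\pi_sV(s)^2,\qquad \|V\|_{\rm Dir}^2=\tfrac12\sum_{s,s'}\pi_sP(s,s')(V(s')-V(s))^2 .$$ Let $\phi:\mathcal S\to\mathbb R^K$ have linearly independent coordinate functions and satisfy $\|\phi(s)\|_2^2\le 1$ for all $s$, and let $V_\theta(s)=\theta^T\phi(s)$. Let $\Theta\subset\mathbb R^K$ be a convex set all of whose elements have norm at most $R$, let $\theta_0\in\Theta$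 be deterministic, let $T\ge 1$ be an integer and put $G=r_{\max}+2R$. Let $(s_t,a_t)_{t\ge0}$ be the trajectory of the process under the policy $\mu$, with $s_0$ distributed according to $\pi$. For a discount factor $\gamma\in(0,1)$, let $\theta^*$ be the solution of the projected Bellman equation, i.e. $V_{\theta^*}$ is the $\|\cdot\|_D$-orthogonal projection of $\mathcal T V_{\theta^*}$ on $\{V_\theta:\theta\in\mathbb R^K\}$, where $(\mathcal TV)(s)=\sum_{a,s'}\mu(s,a)\mathcal P(s'|s,a)(r(s,a,s')+\gamma V(s'))$. Suppose that $\theta^*\in\Theta$ and that $(\theta_t)$ is generated from $\theta_0$ by projected TD(0), $$\theta_{t+1}={\rm Proj}_\Theta\bigl(\theta_t+\alpha_t\,(r(s_t,a_t,s_{t+1})+\gamma V_{\theta_t}(s_{t+1})-V_{\theta_t}(s_t))\,\phi(s_t)\bigr),$$ with $\alpha_0=\dots=\alpha_T=1/\sqrt T$ (the nearest points are assumed to exist, as they do when $\Theta$ is closed). Let $\bar\theta_T=\frac1T\sum_{t=0}^{T-1}\theta_t$. Then $\|V_{\theta^*}-V_{\bar\theta_T}\|_D^2$ and $\|V_{\theta^*}-V_{\bar\theta_T}\|_{\rm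 Dir}^2$ are integrable and $$E\left[(1-\gamma)\|V_{\theta^*}-V_{\bar\theta_T}\|_D^2+\gamma\|V_{\theta^*}-V_{\bar\theta_T}\|_{\rm Dir}^2\right]\le\frac{\|\theta^*-\theta_0\|_2^2+G^2\left[9+12\,\tau^{\rm mix}(1/\sqrt T)\right]}{2\sqrt T}.$$ Consequently $$E\left[\|V_{\theta^*}-V_{\bar\theta_T}\|_{\rm Dir}^2\right]\le\frac{\|\theta^*-\theta_0\|_2^2+G^2\left[9+12\,\tau^{\rm mix}(1/\sqrt T)\right]}{2\gamma\sqrt T},$$ and the Dirichlet error does not blow up as $\gamma\to1$: for every $\gamma_0>0$ and every $\gamma\in[\gamma_0,1)$ for which $\theta^*=\theta^*(\gamma)\in\Theta$, with all other data fixed, $$E\left[\|V_{\theta^*}-V_{\bar\theta_T}\|_{\rm Dir}^2\right]\le\frac{4R^2+G^2\left[9+12\,\tau^{\rm mix}(1/\sqrt T)\right]}{2\gamma_0\sqrt T},$$ whose right-hand side does not depend on $\gamma$. -/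

import Mathlib

open MeasureTheory
open scoped BigOperators RealInnerProductSpace

noncomputable section

namespace TDLearning

/-- A finite Markov decision process with states `S`, actions `A`, transition probabilities
`trans s a s' = 𝒫(s' | s, a)` and deterministic rewards `reward s a s'`.
The discount factor `γ` is kept as a separate parameter, so that it can be varied
while everything else is held fixed. -/
structure MDP (S A : Type*) [Fintype S] where
  trans : S → A → S → ℝ
  trans_nonneg : ∀ s a s', 0 ≤ trans s a s'
  trans_sum : ∀ s a, ∑ s', trans s a s' = 1
  reward : S → A → S → ℝ

/-- A stationary randomized policy: `prob s a` is the probability of action `a` in state `s`. -/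
structure Policy (S A : Type*) [Fintype A] where
  prob : S → A → ℝ
  prob_nonneg : ∀ s a, 0 ≤ prob s a
  prob_sum : ∀ s, ∑ a, prob s a = 1

section Chain

variable {S A : Type*} [Fintype S] [Fintype A]

/-- The transition matrix `P^μ(s,s') = ∑ₐ μ(s,a) 𝒫(s'|s,a)` of the policy. -/
def transMatrix (M : MDP S A) (μ : Policy S A) : Matrix S S ℝ :=
  fun s s' => ∑ a, μ.prob s a * M.trans s a s'

/-- Every state has period one: the only common divisor of the possible return times is `1`. -/
def IsAperiodic [DecidableEq S] (P : Matrix S S ℝ) : Prop :=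
  ∀ s : S, ∀ d : ℕ, (∀ k : ℕ, 1 ≤ k → 0 < (P ^ k) s s → d ∣ k) → d = 1

/-- `π` is a probability vector with `π P = π`. -/
def IsStationaryDist (P : Matrix S S ℝ) (π : S → ℝ) : Prop :=
  π ∈ stdSimplex ℝ S ∧ Matrix.vecMul π P = π

/-- Total variation distance of two probability vectors on a finite set. -/
def tvDist (p q : S → ℝ) : ℝ :=
  (1 / 2) * ∑ s, |p s - q s|

/-- Uniform geometric mixing: `sup_s d_TV(P^t(s,·), π) ≤ m ρ^t` for all `t ≥ 0`. -/
def UniformlyMixing [DecidableEq S] (P : Matrix S S ℝ) (π : S → ℝ) (m ρ : ℝ) : Prop :=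
  ∀ (t : ℕ) (s : S), tvDist ((P ^ t) s) π ≤ m * ρ ^ t

/-- `‖V‖_D² = ∑_s π_s V(s)²`. -/
def sqNormD (π V : S → ℝ) : ℝ :=
  ∑ s, π s * V s ^ 2

/-- The squared Dirichlet seminorm `‖V‖_Dir² = ½ ∑_{s,s'} π_s P(s,s') (V(s') - V(s))²`. -/
def sqNormDir (P : Matrix S S ℝ) (π V : S → ℝ) : ℝ :=
  (1 / 2) * ∑ s, ∑ s', π s * P s s' * (V s' - V s) ^ 2

/-- The Bellman operator `(T V)(s) = ∑ₐ ∑_{s'} μ(s,a) 𝒫(s'|s,a) (r(s,a,s') + γ V(s'))`. -/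
def bellman (M : MDP S A) (μ : Policy S A) (γ : ℝ) (V : S → ℝ) : S → ℝ :=
  fun s => ∑ a, ∑ s', μ.prob s a * M.trans s a s' * (M.reward s a s' + γ * V s')

/-- The law of the trajectory `s₀, a₀, s₁, a₁, …`: the initial state has distribution `π`, actions
are drawn from the policy and next states from the transition probabilities. It is given by
the probabilities of all finite initial segments. -/
structure IsTrajectory {Ω : Type*} [MeasurableSpace Ω] [MeasurableSpace S] [MeasurableSpace A]
    (M : MDP S A) (μ : Policy S A) (π : S → ℝ) (ℙ : Measure Ω)
    (s : ℕ → Ω → S) (a : ℕ → Ω → A) : Prop where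
  measurable_state : ∀ t, Measurable (s t)
  measurable_action : ∀ t, Measurable (a t)
  law : ∀ (n : ℕ) (x : ℕ → S) (b : ℕ → A),
    ℙ.real {ω | (∀ i ≤ n, s i ω = x i) ∧ (∀ i < n, a i ω = b i)} =
      π (x 0) * ∏ i ∈ Finset.range n,
        μ.prob (x i) (b i) * M.trans (x i) (b i) (x (i + 1))

end Chain

/-- The smallest `t ≥ 1` with `m ρ^t ≤ ε`. -/
def mixTime (m ρ ε : ℝ) : ℕ :=
  sInf {t : ℕ | 1 ≤ t ∧ m * ρ ^ t ≤ ε}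

/-- `y` is the projection of `x` on `Θ`, that is, a nearest point of `Θ`
(there is at most one when `Θ` is convex). -/
def IsProj {E : Type*} [PseudoMetricSpace E] (Θ : Set E) (x y : E) : Prop :=
  y ∈ Θ ∧ ∀ z ∈ Θ, dist x y ≤ dist x z

section Linear

variable {S A : Type*} [Fintype S] [Fintype A] {K : ℕ}

/-- Linear value function approximation `V_θ(s) = θᵀ φ(s)`. -/
def value (φ : S → EuclideanSpace ℝ (Fin K)) (θ : EuclideanSpace ℝ (Fin K)) : S → ℝ :=
  fun s => ⟪θ, φ s⟫

/-- The `K` features are linearly independent functions on `S` and `‖φ(s)‖₂² ≤ 1`. -/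
def GoodFeatures (φ : S → EuclideanSpace ℝ (Fin K)) : Prop :=
  LinearIndependent ℝ (fun (l : Fin K) (s : S) => φ s l) ∧ ∀ s, ‖φ s‖ ^ 2 ≤ 1

/-- `V_{θ*}` is a fixed point of the projected Bellman equation: it is the projection of
`T V_{θ*}` on `{V_θ}` in the norm `‖·‖_D`. -/
def IsTDFixedPoint (M : MDP S A) (μ : Policy S A) (γ : ℝ) (π : S → ℝ)
    (φ : S → EuclideanSpace ℝ (Fin K)) (θstar : EuclideanSpace ℝ (Fin K)) : Prop :=
  ∀ θ, sqNormD π (bellman M μ γ (value φ θstar) - value φ θstar) ≤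
    sqNormD π (bellman M μ γ (value φ θstar) - value φ θ)

/-- The TD(0) direction `(r(s,a,s') + γ V_θ(s') - V_θ(s)) φ(s)` on the transition
`s → s'` under the action `a`. -/
def tdDirection (M : MDP S A) (γ : ℝ) (φ : S → EuclideanSpace ℝ (Fin K))
    (s : S) (a : A) (s' : S) (θ : EuclideanSpace ℝ (Fin K)) : EuclideanSpace ℝ (Fin K) :=
  (M.reward s a s' + γ * value φ θ s' - value φ θ s) • φ s

/-- `θ` is a run of projected TD(0) along `s, a` from `θ₀` with step sizes `α`:
`θ_{t+1} = Proj_Θ(θ_t + α_t g_t(θ_t))`. -/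
def IsProjectedTD {Ω : Type*} (M : MDP S A) (γ : ℝ) (φ : S → EuclideanSpace ℝ (Fin K))
    (Θ : Set (EuclideanSpace ℝ (Fin K))) (α : ℕ → ℝ) (s : ℕ → Ω → S) (a : ℕ → Ω → A)
    (θ₀ : EuclideanSpace ℝ (Fin K)) (θ : ℕ → Ω → EuclideanSpace ℝ (Fin K)) : Prop :=
  (∀ ω, θ 0 ω = θ₀) ∧
  ∀ t ω, IsProj Θ
    (θ t ω + α t • tdDirection M γ φ (s t ω) (a t ω) (s (t + 1) ω) (θ t ω)) (θ (t + 1) ω)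

/-- The averaged iterate `θ̄_T = (1/T) ∑_{t<T} θ_t`. -/
def avgIterate {Ω : Type*} (θ : ℕ → Ω → EuclideanSpace ℝ (Fin K)) (T : ℕ) (ω : Ω) :
    EuclideanSpace ℝ (Fin K) :=
  (1 / (T : ℝ)) • ∑ t ∈ Finset.range T, θ t ω

/-- `‖V_{θ*} - V_θ‖_D²`. -/
def errD (π : S → ℝ) (φ : S → EuclideanSpace ℝ (Fin K))
    (θstar θ : EuclideanSpace ℝ (Fin K)) : ℝ :=
  sqNormD π (value φ θstar - value φ θ)

/-- `‖V_{θ*} - V_θ‖_Dir²`. -/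
def errDir (P : Matrix S S ℝ) (π : S → ℝ) (φ : S → EuclideanSpace ℝ (Fin K))
    (θstar θ : EuclideanSpace ℝ (Fin K)) : ℝ :=
  sqNormDir P π (value φ θstar - value φ θ)

end Linear

end TDLearning

end

open MeasureTheory
open scoped BigOperators RealInnerProductSpace

namespace TDLearning

/-! ### One-step averages, stationarity and total variation. -/

section StepMean

variable {S A : Type*} [Fintype S] [Fintype A]

/-! The stationary mean `ḡ(θ)` of the TD direction behaves like a descent direction. With `W =
V_{θ*} - V_θ`, the orthogonality `⟪ḡ(θ*), ·⟫ = 0` cancels the rewards, and stationarity of `π` gives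
`⟪ḡ(θ), θ* - θ⟫ = ‖W‖_D² - γ ⟪W, PW⟫_π = (1-γ)‖W‖_D² + γ‖W‖_Dir²` (`inner_meanDirection_eq_err`).
This identity is where the Dirichlet term, and hence a bound without `1/(1-γ)`, comes from.

The rest is projected stochastic approximation with step `ε = 1/√T`. Expanding `‖θ_{t+1} - θ*‖²`
bounds `2ε` times the error by a telescoping difference, plus `ε²G²`, plus `2ε` times the bias of
the direction (`IsProjectedTD.step_le`). The bias is not centred, because `θ_t` and `s_t` are
correlated. It is `6G`-Lipschitz in `θ`, so `θ_t` may be replaced by the iterate `τ` steps earlier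
at cost `6G²τε`. Mixing then leaves at most `4G² m ρ^τ ≤ 4G²ε`
(`IsTrajectory.integral_gradBias_le`). Thus each step costs `ε²G²(1 + 2(4 + 6τ)) = ε²G²(9 + 12τ)`;
as `Tε² = 1`, summing and using convexity for the averaged iterate gives the bound. -/

/-- The mean of `f a s'` when `a` and `s'` are drawn by the policy in state `x`. -/
def stepMean {E : Type*} [AddCommMonoid E] [Module ℝ E] (M : MDP S A) (μ : Policy S A)
    (f : A → S → E) (x : S) : E :=
  ∑ a, ∑ y, (μ.prob x a * M.trans x a y) • f a y

theorem stepMean_const {E : Type*} [AddCommGroup E] [Module ℝ E] (M : MDP S A) (μ : Policy S A)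
    (c : E) (x : S) : stepMean M μ (fun _ _ => c) x = c := by
  simp [stepMean, ← Finset.sum_smul, ← Finset.mul_sum, M.trans_sum, μ.prob_sum]

theorem stepMean_sub {E : Type*} [AddCommGroup E] [Module ℝ E] (M : MDP S A) (μ : Policy S A)
    (f g : A → S → E) (x : S) :
    stepMean M μ (fun a y => f a y - g a y) x = stepMean M μ f x - stepMean M μ g x := by
  simp [stepMean, smul_sub, Finset.sum_sub_distrib]

theorem stepMean_inner {E : Type*} [NormedAddCommGroup E] [InnerProductSpace ℝ E] (M : MDP S A)
    (μ : Policy S A) (f : A → S → E) (v : E) (x : S) :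
    stepMean M μ (fun a y => ⟪f a y, v⟫) x = ⟪stepMean M μ f x, v⟫ := by
  simp [stepMean, sum_inner, real_inner_smul_left]

theorem stepMean_smul_const {E : Type*} [AddCommGroup E] [Module ℝ E] (M : MDP S A)
    (μ : Policy S A) (f : A → S → ℝ) (v : E) (x : S) :
    stepMean M μ (fun a y => f a y • v) x = stepMean M μ f x • v := by
  simp [stepMean, Finset.sum_smul, smul_smul]

theorem stepMean_state (M : MDP S A) (μ : Policy S A) (f : S → ℝ) (x : S) :
    stepMean M μ (fun _ y => f y) x = ∑ y, transMatrix M μ x y * f y := by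
  simp only [stepMean, transMatrix, Finset.sum_mul, smul_eq_mul]
  exact Finset.sum_comm

theorem norm_stepMean_le {E : Type*} [NormedAddCommGroup E] [NormedSpace ℝ E] (M : MDP S A)
    (μ : Policy S A) {f : A → S → E} {C : ℝ} (hf : ∀ a y, ‖f a y‖ ≤ C) (x : S) :
    ‖stepMean M μ f x‖ ≤ C := by
  have hw : ∀ a y, 0 ≤ μ.prob x a * M.trans x a y := fun a y =>
    mul_nonneg (μ.prob_nonneg _ _) (M.trans_nonneg _ _ _)
  calc ‖stepMean M μ f x‖ ≤ ∑ a, ∑ y, (μ.prob x a * M.trans x a y) * C := by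
        refine (norm_sum_le _ _).trans (Finset.sum_le_sum fun a _ =>
          (norm_sum_le _ _).trans (Finset.sum_le_sum fun y _ => ?_))
        rw [norm_smul, Real.norm_of_nonneg (hw a y)]
        exact mul_le_mul_of_nonneg_left (hf a y) (hw a y)
    _ = C := stepMean_const M μ C x

theorem transMatrix_row_sum (M : MDP S A) (μ : Policy S A) (x : S) :
    ∑ y, transMatrix M μ x y = 1 := by
  simpa using (stepMean_state M μ (fun _ => 1) x).symm.trans (stepMean_const M μ 1 x)

theorem norm_sum_smul_le_of_mem_stdSimplex {E : Type*} [NormedAddCommGroup E] [NormedSpace ℝ E]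
    {π : S → ℝ} (hπ : π ∈ stdSimplex ℝ S) {f : S → E} {C : ℝ} (hf : ∀ x, ‖f x‖ ≤ C) :
    ‖∑ x, π x • f x‖ ≤ C := by
  calc ‖∑ x, π x • f x‖ ≤ ∑ x, π x * C := by
        refine (norm_sum_le _ _).trans (Finset.sum_le_sum fun x _ => ?_)
        rw [norm_smul, Real.norm_of_nonneg (hπ.1 x)]
        exact mul_le_mul_of_nonneg_left (hf x) (hπ.1 x)
    _ = C := by rw [← Finset.sum_mul, hπ.2, one_mul]

theorem IsStationaryDist.vecMul_pow [DecidableEq S] {P : Matrix S S ℝ} {π : S → ℝ}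
    (hπ : IsStationaryDist P π) (k : ℕ) : Matrix.vecMul π (P ^ k) = π := by
  induction k with
  | zero => simp
  | succ k ih => rw [pow_succ, ← Matrix.vecMul_vecMul, ih, hπ.2]

theorem IsStationaryDist.sum_mul_mul {P : Matrix S S ℝ} {π : S → ℝ}
    (hπ : Matrix.vecMul π P = π) (f : S → ℝ) :
    ∑ x, π x * ∑ y, P x y * f y = ∑ y, π y * f y := by
  simp only [Finset.mul_sum]
  rw [Finset.sum_comm]
  refine Finset.sum_congr rfl fun y _ => ?_
  conv_rhs => rw [← hπ]
  simp [Matrix.vecMul, dotProduct, Finset.sum_mul, mul_assoc]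

/-- The factor 2 undoes the `1/2` in `tvDist`. -/
theorem abs_sum_sub_mul_le_tvDist (p q f : S → ℝ) {C : ℝ} (hf : ∀ x, |f x| ≤ C) :
    |∑ x, (p x - q x) * f x| ≤ 2 * C * tvDist p q := by
  calc |∑ x, (p x - q x) * f x| ≤ ∑ x, |p x - q x| * C := by
        refine (Finset.abs_sum_le_sum_abs _ _).trans (Finset.sum_le_sum fun x _ => ?_)
        rw [abs_mul]
        exact mul_le_mul_of_nonneg_left (hf x) (abs_nonneg _)
    _ = 2 * C * tvDist p q := by rw [← Finset.sum_mul, tvDist]; ring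

end StepMean

/-! ### Functions of a finite history. -/

section History

variable {S A Ω β δ : Type*} {s : ℕ → Ω → S} {a : ℕ → Ω → A}

/-- The history `s₀, …, sₙ, a₀, …, aₙ₋₁`. -/
def history (s : ℕ → Ω → S) (a : ℕ → Ω → A) (n : ℕ) (ω : Ω) : (Fin (n + 1) → S) × (Fin n → A) :=
  (fun i => s i ω, fun i => a i ω)

/-- `F` is a function of the history up to time `n`. -/
def DependsOnHistory (s : ℕ → Ω → S) (a : ℕ → Ω → A) (n : ℕ) (F : Ω → β) : Prop :=
  ∀ ω ω', (∀ i ≤ n, s i ω = s i ω') → (∀ i < n, a i ω = a i ω') → F ω = F ω'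

theorem DependsOnHistory.mono {n k : ℕ} (h : n ≤ k) {F : Ω → β}
    (hF : DependsOnHistory s a n F) : DependsOnHistory s a k F :=
  fun ω ω' hs ha => hF ω ω' (fun i hi => hs i (hi.trans h)) fun i hi => ha i (hi.trans_le h)

theorem DependsOnHistory.comp {n : ℕ} {F : Ω → β} (hF : DependsOnHistory s a n F) (g : β → δ) :
    DependsOnHistory s a n fun ω => g (F ω) :=
  fun ω ω' hs ha => congrArg g (hF ω ω' hs ha)

theorem DependsOnHistory.state {n i : ℕ} (hi : i ≤ n) : DependsOnHistory s a n (s i) :=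
  fun _ _ hs _ => hs i hi

theorem DependsOnHistory.action {n i : ℕ} (hi : i < n) : DependsOnHistory s a n (a i) :=
  fun _ _ _ ha => ha i hi

theorem DependsOnHistory.prodMk {n : ℕ} {F : Ω → β} {G : Ω → δ} (hF : DependsOnHistory s a n F)
    (hG : DependsOnHistory s a n G) : DependsOnHistory s a n fun ω => (F ω, G ω) :=
  fun ω ω' hs ha => Prod.ext (hF ω ω' hs ha) (hG ω ω' hs ha)

/-- For finite `S` and `A` the history has finitely many values, so this factorization makes
integrals finite sums and yields measurability without assuming it of the iterates. -/
theorem DependsOnHistory.exists_eq_comp [Nonempty β] {n : ℕ} {F : Ω → β}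
    (hF : DependsOnHistory s a n F) :
    ∃ f : (Fin (n + 1) → S) × (Fin n → A) → β, ∀ ω, F ω = f (history s a n ω) := by
  have h : Function.FactorsThrough F (history s a n) := by
    intro ω ω' hω
    refine hF ω ω' (fun i hi => ?_) fun i hi => ?_
    · exact congrFun (congrArg Prod.fst hω) ⟨i, Nat.lt_succ_of_le hi⟩
    · exact congrFun (congrArg Prod.snd hω) ⟨i, hi⟩
  obtain ⟨f, hf⟩ := (Function.factorsThrough_iff F).1 h
  exact ⟨f, fun ω => congrFun hf ω⟩

end History

theorem integral_comp_eq_sum {Ω ι : Type*} [MeasurableSpace Ω] (ℙ : Measure Ω)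
    [IsFiniteMeasure ℙ] [Fintype ι] [MeasurableSpace ι] [MeasurableSingletonClass ι]
    {X : Ω → ι} (hX : Measurable X) (f : ι → ℝ) :
    ∫ ω, f (X ω) ∂ℙ = ∑ i, ℙ.real {ω | X ω = i} * f i := by
  rw [← integral_map hX.aemeasurable (measurable_of_finite f).aestronglyMeasurable,
    integral_fintype .of_finite]
  refine Finset.sum_congr rfl fun i _ => ?_
  rw [map_measureReal_apply hX (measurableSet_singleton i), smul_eq_mul]
  rfl

theorem IsTrajectory.measurable_history {S A Ω : Type*} [Fintype S] [Fintype A]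
    [MeasurableSpace S] [MeasurableSpace A] [MeasurableSpace Ω] {ℙ : Measure Ω} {M : MDP S A}
    {μ : Policy S A} {π : S → ℝ} {s : ℕ → Ω → S} {a : ℕ → Ω → A}
    (h : IsTrajectory M μ π ℙ s a) (n : ℕ) :
    Measurable (history s a n) :=
  (measurable_pi_lambda _ fun _ => h.measurable_state _).prodMk
    (measurable_pi_lambda _ fun _ => h.measurable_action _)

/-! ### The Markov property in integrated form. -/

section Trajectory

variable {S A : Type*} [Fintype S] [Fintype A]
  [MeasurableSpace S] [MeasurableSingletonClass S]
  [MeasurableSpace A] [MeasurableSingletonClass A]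
  {Ω : Type*} [MeasurableSpace Ω] {ℙ : Measure Ω} [IsProbabilityMeasure ℙ]
  {M : MDP S A} {μ : Policy S A} {π : S → ℝ} {s : ℕ → Ω → S} {a : ℕ → Ω → A}

theorem IsTrajectory.integrable (h : IsTrajectory M μ π ℙ s a) {n : ℕ} {F : Ω → ℝ}
    (hF : DependsOnHistory s a n F) : Integrable F ℙ := by
  obtain ⟨f, hf⟩ := hF.exists_eq_comp
  have hint : Integrable f (ℙ.map (history s a n)) :=
    have := Measure.isProbabilityMeasure_map (μ := ℙ) (h.measurable_history n).aemeasurable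
    .of_finite
  rw [funext hf]
  exact hint.comp_measurable (h.measurable_history n)

theorem IsTrajectory.measureReal_step (h : IsTrajectory M μ π ℙ s a) (n : ℕ)
    (z : (Fin (n + 1) → S) × (Fin n → A)) (b : A) (y : S) :
    ℙ.real {ω | (history s a n ω, a n ω, s (n + 1) ω) = (z, b, y)} =
      ℙ.real {ω | history s a n ω = z} *
        (μ.prob (z.1 (Fin.last n)) b * M.trans (z.1 (Fin.last n)) b y) := by
  -- The law is stated for infinite sequences. The default values `y` and `b` are chosen so that
  -- index `n + 1` of `x` and index `n` of `c` carry the new state and action.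
  set x : ℕ → S := fun i => if hi : i < n + 1 then z.1 ⟨i, hi⟩ else y with hx
  set c : ℕ → A := fun i => if hi : i < n then z.2 ⟨i, hi⟩ else b with hc
  have hxi : ∀ i : Fin (n + 1), x i = z.1 i := fun i => dif_pos i.2
  have hci : ∀ i : Fin n, c i = z.2 i := fun i => dif_pos i.2
  have hxn : x n = z.1 (Fin.last n) := hxi (Fin.last n)
  have hxy : x (n + 1) = y := by simp [hx]
  have hcn : c n = b := by simp [hc]
  have hz : ∀ ω, history s a n ω = z ↔ (∀ i ≤ n, s i ω = x i) ∧ ∀ i < n, a i ω = c i := by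
    intro ω
    simp only [history, Prod.ext_iff, funext_iff, ← hxi, ← hci]
    constructor
    · exact fun H => ⟨fun i hi => H.1 ⟨i, Nat.lt_succ_of_le hi⟩, fun i hi => H.2 ⟨i, hi⟩⟩
    · exact fun H => ⟨fun i => H.1 i (Nat.le_of_lt_succ i.2), fun i => H.2 i i.2⟩
  have hset : {ω | (history s a n ω, a n ω, s (n + 1) ω) = (z, b, y)} =
      {ω | (∀ i ≤ n + 1, s i ω = x i) ∧ ∀ i < n + 1, a i ω = c i} := by
    ext ω
    simp only [Set.mem_ofPred_eq, Prod.mk.injEq, hz, Nat.le_succ_iff, Nat.lt_succ_iff_lt_or_eq,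
      or_imp, forall_and, forall_eq, hxy, hcn]
    tauto
  have hset' : {ω | history s a n ω = z} =
      {ω | (∀ i ≤ n, s i ω = x i) ∧ ∀ i < n, a i ω = c i} := by
    ext ω
    exact hz ω
  rw [hset, hset', h.law, h.law, Finset.prod_range_succ, hxn, hxy, hcn, mul_assoc]

/-- Plays the role of conditioning on the history: by `measureReal_step` the next action and state
have the one-step law at `s n`, whatever the past. -/
theorem IsTrajectory.integral_step (h : IsTrajectory M μ π ℙ s a) (n : ℕ) (F : Ω → A → S → ℝ)
    (hF : DependsOnHistory s a n F) :
    ∫ ω, F ω (a n ω) (s (n + 1) ω) ∂ℙ = ∫ ω, stepMean M μ (F ω) (s n ω) ∂ℙ := by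
  obtain ⟨f, hf⟩ := hF.exists_eq_comp
  simp only [hf]
  have h1 := integral_comp_eq_sum ℙ ((h.measurable_history n).prodMk
    ((h.measurable_action n).prodMk (h.measurable_state (n + 1))))
    (fun p => f p.1 p.2.1 p.2.2)
  have h2 := integral_comp_eq_sum ℙ (h.measurable_history n)
    (fun z => stepMean M μ (f z) (z.1 (Fin.last n)))
  refine h1.trans (Eq.trans ?_ h2.symm)
  rw [Fintype.sum_prod_type]
  refine Finset.sum_congr rfl fun z _ => ?_
  rw [Fintype.sum_prod_type, stepMean, Finset.mul_sum]
  refine Finset.sum_congr rfl fun b _ => ?_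
  rw [Finset.mul_sum]
  refine Finset.sum_congr rfl fun y _ => ?_
  rw [h.measureReal_step, smul_eq_mul, mul_assoc]

/-- Averaging out the last step replaces `F ω` by `P (F ω)`, again a function of the history up to
`n`; hence the induction over all `F`. -/
theorem IsTrajectory.integral_state_add [DecidableEq S] (h : IsTrajectory M μ π ℙ s a) (n k : ℕ)
    (F : Ω → S → ℝ) (hF : DependsOnHistory s a n F) :
    ∫ ω, F ω (s (n + k) ω) ∂ℙ = ∫ ω, ∑ y, (transMatrix M μ ^ k) (s n ω) y * F ω y ∂ℙ := by
  induction k generalizing F with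
  | zero => simp [Matrix.one_apply]
  | succ k ih =>
    have h1 := h.integral_step (n + k) (fun ω _ y => F ω y)
      ((hF.mono (Nat.le_add_right n k)).comp fun f _ y => f y)
    simp only [stepMean_state] at h1
    rw [← add_assoc, h1,
      ih (fun ω x => ∑ y, transMatrix M μ x y * F ω y)
        (hF.comp fun f x => ∑ y, transMatrix M μ x y * f y)]
    congr 1 with ω
    simp only [pow_succ, Matrix.mul_apply, Finset.sum_mul, Finset.mul_sum]
    rw [Finset.sum_comm]
    simp only [mul_assoc]

theorem IsTrajectory.integral_initial (h : IsTrajectory M μ π ℙ s a) (f : S → ℝ) :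
    ∫ ω, f (s 0 ω) ∂ℙ = ∑ x, π x * f x := by
  rw [integral_comp_eq_sum ℙ (h.measurable_state 0)]
  refine Finset.sum_congr rfl fun x _ => ?_
  -- The law needs some action sequence even for `n = 0`, where it imposes no condition; a sample
  -- path supplies one.
  have ω₀ : Ω := (nonempty_of_isProbabilityMeasure ℙ).some
  have hl := h.law 0 (fun _ => x) (fun i => a i ω₀)
  simp only [Nat.le_zero, forall_eq, Nat.not_lt_zero, false_imp_iff, implies_true, and_true,
    Finset.range_zero, Finset.prod_empty, mul_one] at hl
  rw [hl]

theorem IsTrajectory.integral_stationary [DecidableEq S] (h : IsTrajectory M μ π ℙ s a)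
    (hπ : IsStationaryDist (transMatrix M μ) π) (t : ℕ) (f : S → ℝ) :
    ∫ ω, f (s t ω) ∂ℙ = ∑ x, π x * f x := by
  have h1 := h.integral_state_add 0 t (fun _ => f) fun _ _ _ _ => rfl
  rw [zero_add] at h1
  rw [h1, h.integral_initial fun x => ∑ y, (transMatrix M μ ^ t) x y * f y,
    IsStationaryDist.sum_mul_mul (hπ.vecMul_pow t)]

end Trajectory

/-! ### Projection on a convex set. -/

section Projection

variable {E : Type*} [NormedAddCommGroup E] [InnerProductSpace ℝ E] {Θ : Set E}

theorem IsProj.inner_le_zero (hΘ : Convex ℝ Θ) {x y : E} (h : IsProj Θ x y) {z : E}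
    (hz : z ∈ Θ) : ⟪x - y, z - y⟫ ≤ 0 := by
  refine (norm_eq_iInf_iff_real_inner_le_zero hΘ h.1).1 ?_ z hz
  have : Nonempty Θ := ⟨⟨y, h.1⟩⟩
  refine le_antisymm (le_ciInf fun w => ?_) (ciInf_le ⟨0, ?_⟩ (⟨y, h.1⟩ : Θ))
  · simpa [dist_eq_norm] using h.2 w w.2
  · rintro _ ⟨w, rfl⟩
    exact norm_nonneg _

theorem IsProj.norm_sub_le (hΘ : Convex ℝ Θ) {x y : E} (h : IsProj Θ x y) {z : E}
    (hz : z ∈ Θ) : ‖y - z‖ ≤ ‖x - z‖ := by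
  have h1 := h.inner_le_zero hΘ hz
  have h2 := norm_sub_sq_real (x - y) (z - y)
  rw [sub_sub_sub_cancel_right, norm_sub_rev z y] at h2
  exact (sq_le_sq₀ (norm_nonneg _) (norm_nonneg _)).1 (by nlinarith [sq_nonneg ‖x - y‖])

/-- Adding the two obtuse-angle inequalities gives `‖y' - y‖² ≤ 0`. Uniqueness is what makes the
iterates functions of the history. -/
theorem IsProj.unique (hΘ : Convex ℝ Θ) {x y y' : E} (h : IsProj Θ x y) (h' : IsProj Θ x y') :
    y = y' := by
  have h1 := h.inner_le_zero hΘ h'.1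
  have h2 := h'.inner_le_zero hΘ h.1
  have h3 : ⟪y' - y, y' - y⟫ = ⟪x - y, y' - y⟫ + ⟪x - y', y - y'⟫ := by
    rw [← neg_sub y' y, inner_neg_right, ← sub_eq_add_neg, ← inner_sub_left]
    simp
  rw [real_inner_self_eq_norm_sq] at h3
  have h4 : ‖y' - y‖ = 0 := by nlinarith [norm_nonneg (y' - y), sq_nonneg ‖y' - y‖]
  exact (sub_eq_zero.1 (norm_eq_zero.1 h4)).symm

end Projection

theorem value_sub {S : Type*} {K : ℕ} (φ : S → EuclideanSpace ℝ (Fin K))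
    (θ θ' : EuclideanSpace ℝ (Fin K)) : value φ (θ - θ') = value φ θ - value φ θ' := by
  ext x
  simp [value, inner_sub_left]

theorem abs_value_le {S : Type*} {K : ℕ} {φ : S → EuclideanSpace ℝ (Fin K)} (hφ : ∀ x, ‖φ x‖ ≤ 1)
    (θ : EuclideanSpace ℝ (Fin K)) (x : S) : |value φ θ x| ≤ ‖θ‖ :=
  (abs_real_inner_le_norm _ _).trans (mul_le_of_le_one_right (norm_nonneg _) (hφ x))

/-! ### Size and Lipschitz constant of the TD direction. -/

section TDDirection

variable {S A : Type*} [Fintype S] {K : ℕ} {M : MDP S A} {γ : ℝ}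
  {φ : S → EuclideanSpace ℝ (Fin K)} {rmax R : ℝ}

theorem norm_tdDirection_le (hγ0 : 0 ≤ γ) (hγ1 : γ ≤ 1) (hφ : ∀ x, ‖φ x‖ ≤ 1)
    (hr : ∀ s a s', |M.reward s a s'| ≤ rmax) {θ : EuclideanSpace ℝ (Fin K)} (hθ : ‖θ‖ ≤ R)
    (x : S) (b : A) (y : S) : ‖tdDirection M γ φ x b y θ‖ ≤ rmax + 2 * R := by
  rw [tdDirection, norm_smul, Real.norm_eq_abs]
  refine (mul_le_of_le_one_right (abs_nonneg _) (hφ x)).trans ?_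
  have h1 := abs_le.1 (hr x b y)
  have h2 := abs_le.1 ((abs_value_le hφ θ x).trans hθ)
  have h3 : |γ * value φ θ y| ≤ R := by
    rw [abs_mul, abs_of_nonneg hγ0]
    exact (mul_le_of_le_one_left (abs_nonneg _) hγ1).trans ((abs_value_le hφ θ y).trans hθ)
  have h3 := abs_le.1 h3
  rw [abs_le]
  constructor <;> linarith

theorem norm_tdDirection_sub_le (hγ0 : 0 ≤ γ) (hγ1 : γ ≤ 1) (hφ : ∀ x, ‖φ x‖ ≤ 1)
    (θ θ' : EuclideanSpace ℝ (Fin K)) (x : S) (b : A) (y : S) :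
    ‖tdDirection M γ φ x b y θ - tdDirection M γ φ x b y θ'‖ ≤ 2 * ‖θ - θ'‖ := by
  have h0 : tdDirection M γ φ x b y θ - tdDirection M γ φ x b y θ' =
      (γ * value φ (θ - θ') y - value φ (θ - θ') x) • φ x := by
    rw [tdDirection, tdDirection, ← sub_smul, value_sub, Pi.sub_apply, Pi.sub_apply]
    congr 1
    ring
  rw [h0, norm_smul, Real.norm_eq_abs]
  refine (mul_le_of_le_one_right (abs_nonneg _) (hφ x)).trans ((abs_sub _ _).trans ?_)
  rw [abs_mul, abs_of_nonneg hγ0]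
  have h1 := mul_le_of_le_one_left (abs_nonneg (value φ (θ - θ') y)) hγ1
  have h2 := abs_value_le hφ (θ - θ') y
  have h3 := abs_value_le hφ (θ - θ') x
  linarith

end TDDirection

/-! ### The mean direction and its splitting into the two error terms. -/

section Direction

variable {S A : Type*} [Fintype S] [Fintype A] {K : ℕ}

/-- The mean of the TD(0) direction in the stationary regime. -/
noncomputable def meanDirection (M : MDP S A) (μ : Policy S A) (γ : ℝ) (π : S → ℝ)
    (φ : S → EuclideanSpace ℝ (Fin K)) (θ : EuclideanSpace ℝ (Fin K)) :
    EuclideanSpace ℝ (Fin K) :=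
  ∑ x, π x • stepMean M μ (fun b y => tdDirection M γ φ x b y θ) x

/-- The bias of the TD(0) direction, tested against `θ - θ*`. -/
noncomputable def gradBias (M : MDP S A) (μ : Policy S A) (γ : ℝ) (π : S → ℝ)
    (φ : S → EuclideanSpace ℝ (Fin K)) (θstar θ : EuclideanSpace ℝ (Fin K))
    (x : S) (b : A) (y : S) : ℝ :=
  ⟪tdDirection M γ φ x b y θ - meanDirection M μ γ π φ θ, θ - θstar⟫

theorem stepMean_tdDirection (M : MDP S A) (μ : Policy S A) (γ : ℝ)
    (φ : S → EuclideanSpace ℝ (Fin K)) (θ : EuclideanSpace ℝ (Fin K)) (x : S) :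
    stepMean M μ (fun b y => tdDirection M γ φ x b y θ) x =
      (bellman M μ γ (value φ θ) x - value φ θ x) • φ x := by
  simp only [tdDirection]
  rw [stepMean_smul_const, stepMean_sub M μ (fun b y => M.reward x b y + γ * value φ θ y)
    (fun _ _ => value φ θ x), stepMean_const]
  rfl

theorem inner_meanDirection (M : MDP S A) (μ : Policy S A) (γ : ℝ) (π : S → ℝ)
    (φ : S → EuclideanSpace ℝ (Fin K)) (θ v : EuclideanSpace ℝ (Fin K)) :
    ⟪meanDirection M μ γ π φ θ, v⟫ =
      ∑ x, π x * ((bellman M μ γ (value φ θ) x - value φ θ x) * value φ v x) := by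
  simp only [meanDirection, stepMean_tdDirection, sum_inner, real_inner_smul_left]
  exact Finset.sum_congr rfl fun x _ => by rw [real_inner_comm, value, value]

theorem bellman_sub (M : MDP S A) (μ : Policy S A) (γ : ℝ) (V W : S → ℝ) (x : S) :
    bellman M μ γ V x - bellman M μ γ W x =
      γ * ∑ y, transMatrix M μ x y * (V y - W y) := by
  have h := stepMean_sub M μ (fun b y => M.reward x b y + γ * V y)
    (fun b y => M.reward x b y + γ * W y) x
  simp only [add_sub_add_left_eq_sub, ← mul_sub] at h
  rw [stepMean_state M μ fun y => γ * (V y - W y)] at h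
  refine h.symm.trans ?_
  rw [Finset.mul_sum]
  exact Finset.sum_congr rfl fun y _ => mul_left_comm _ _ _

/-- The Bellman error of the fixed point is orthogonal to all the value functions. -/
theorem IsTDFixedPoint.inner_meanDirection_eq_zero {M : MDP S A} {μ : Policy S A} {γ : ℝ}
    {π : S → ℝ} (hπ : ∀ x, 0 ≤ π x) {φ : S → EuclideanSpace ℝ (Fin K)}
    {θstar : EuclideanSpace ℝ (Fin K)} (h : IsTDFixedPoint M μ γ π φ θstar)
    (v : EuclideanSpace ℝ (Fin K)) : ⟪meanDirection M μ γ π φ θstar, v⟫ = 0 := by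
  rw [inner_meanDirection]
  set B := bellman M μ γ (value φ θstar)
  set c := ∑ x, π x * ((B x - value φ θstar x) * value φ v x) with hc
  set d := ∑ x, π x * value φ v x ^ 2 with hd
  have hd0 : 0 ≤ d := Finset.sum_nonneg fun x _ => mul_nonneg (hπ x) (sq_nonneg _)
  -- First variation: moving `θ*` by `ε v` cannot decrease the distance, so a quadratic in `ε`
  -- without constant term is nonnegative.
  have key : ∀ ε : ℝ, 0 ≤ ε ^ 2 * d - 2 * ε * c := by
    intro ε
    have h1 := h (θstar + ε • v)
    have h2 : sqNormD π (B - value φ (θstar + ε • v)) =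
        sqNormD π (B - value φ θstar) + (ε ^ 2 * d - 2 * ε * c) := by
      simp only [sqNormD, hc, hd, Finset.mul_sum, ← Finset.sum_sub_distrib,
        ← Finset.sum_add_distrib]
      refine Finset.sum_congr rfl fun x _ => ?_
      simp only [Pi.sub_apply, value, inner_add_left, real_inner_smul_left]
      ring
    linarith
  -- The minimizer would be `c / d`; using `d + 1` avoids the case `d = 0` and still gives a
  -- negative value unless `c = 0`.
  have h3 := key (c / (d + 1))
  have h4 : (c / (d + 1)) ^ 2 * d - 2 * (c / (d + 1)) * c = -(c ^ 2 * (d + 2) / (d + 1) ^ 2) := by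
    field_simp
    ring
  rw [h4] at h3
  by_contra hne
  have : 0 < c ^ 2 * (d + 2) / (d + 1) ^ 2 := by positivity
  linarith

/-- Expanding the square, `W(y)²` averages to `‖W‖_D²` by stationarity and `W(x)²` does so by unit
row sums; the cross term remains. -/
theorem sqNormDir_eq {M : MDP S A} {μ : Policy S A} {π : S → ℝ}
    (hπ : Matrix.vecMul π (transMatrix M μ) = π) (W : S → ℝ) :
    sqNormDir (transMatrix M μ) π W =
      sqNormD π W - ∑ x, π x * (W x * ∑ y, transMatrix M μ x y * W y) := by
  have h1 : ∑ x, π x * ∑ y, transMatrix M μ x y * W y ^ 2 = sqNormD π W :=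
    IsStationaryDist.sum_mul_mul hπ _
  have h2 : ∀ x, ∑ y, π x * transMatrix M μ x y * (W y - W x) ^ 2 =
      π x * ∑ y, transMatrix M μ x y * W y ^ 2 + π x * W x ^ 2 -
        2 * (π x * (W x * ∑ y, transMatrix M μ x y * W y)) := by
    intro x
    have : π x * W x ^ 2 = ∑ y, transMatrix M μ x y * (π x * W x ^ 2) := by
      rw [← Finset.sum_mul, transMatrix_row_sum, one_mul]
    rw [this]
    simp only [Finset.mul_sum, ← Finset.sum_add_distrib, ← Finset.sum_sub_distrib]
    exact Finset.sum_congr rfl fun y _ => by ring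
  simp only [sqNormDir, h2, Finset.sum_sub_distrib, Finset.sum_add_distrib, h1,
    ← Finset.mul_sum]
  rw [sqNormD]
  ring

/-- The mean TD(0) direction splits the error into the `D`-norm and the Dirichlet seminorm. -/
theorem inner_meanDirection_eq_err {M : MDP S A} {μ : Policy S A} {γ : ℝ} {π : S → ℝ}
    (hπ : IsStationaryDist (transMatrix M μ) π) {φ : S → EuclideanSpace ℝ (Fin K)}
    {θstar : EuclideanSpace ℝ (Fin K)} (h : IsTDFixedPoint M μ γ π φ θstar)
    (θ : EuclideanSpace ℝ (Fin K)) :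
    ⟪meanDirection M μ γ π φ θ, θstar - θ⟫ =
      (1 - γ) * errD π φ θstar θ + γ * errDir (transMatrix M μ) π φ θstar θ := by
  -- Subtracting this zero turns the Bellman errors into a difference, which is linear in `W` and
  -- free of rewards.
  have h0 := h.inner_meanDirection_eq_zero hπ.1.1 (θstar - θ)
  rw [errDir, sqNormDir_eq hπ.2, ← sub_zero ⟪meanDirection M μ γ π φ θ, θstar - θ⟫, ← h0,
    inner_meanDirection, inner_meanDirection, errD, ← value_sub, value_sub,
    ← Finset.sum_sub_distrib]
  set W := value φ θstar - value φ θ with hW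
  have h1 : ∀ x, π x * ((bellman M μ γ (value φ θ) x - value φ θ x) * W x) -
      π x * ((bellman M μ γ (value φ θstar) x - value φ θstar x) * W x) =
      π x * W x ^ 2 - γ * (π x * (W x * ∑ y, transMatrix M μ x y * W y)) := by
    intro x
    have hb := bellman_sub M μ γ (value φ θstar) (value φ θ) x
    have hWx : W x = value φ θstar x - value φ θ x := rfl
    have hs : ∑ y, transMatrix M μ x y * (value φ θstar y - value φ θ y) =
      ∑ y, transMatrix M μ x y * W y := rfl
    rw [hs] at hb
    linear_combination -π x * W x * hb - π x * W x * hWx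
  simp only [h1, Finset.sum_sub_distrib, ← Finset.mul_sum]
  rw [sqNormD]
  ring

/-! ### Size, Lipschitz constant and stationary mean of the bias. -/

section Bounds

variable {M : MDP S A} {μ : Policy S A} {γ : ℝ} {π : S → ℝ}
  {φ : S → EuclideanSpace ℝ (Fin K)} {rmax R : ℝ}

theorem norm_meanDirection_le (hγ0 : 0 ≤ γ) (hγ1 : γ ≤ 1) (hφ : ∀ x, ‖φ x‖ ≤ 1)
    (hr : ∀ s a s', |M.reward s a s'| ≤ rmax) (hπ : π ∈ stdSimplex ℝ S)
    {θ : EuclideanSpace ℝ (Fin K)} (hθ : ‖θ‖ ≤ R) :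
    ‖meanDirection M μ γ π φ θ‖ ≤ rmax + 2 * R :=
  norm_sum_smul_le_of_mem_stdSimplex hπ fun x =>
    norm_stepMean_le M μ (norm_tdDirection_le hγ0 hγ1 hφ hr hθ x) x

theorem norm_meanDirection_sub_le (hγ0 : 0 ≤ γ) (hγ1 : γ ≤ 1) (hφ : ∀ x, ‖φ x‖ ≤ 1)
    (hπ : π ∈ stdSimplex ℝ S) (θ θ' : EuclideanSpace ℝ (Fin K)) :
    ‖meanDirection M μ γ π φ θ - meanDirection M μ γ π φ θ'‖ ≤ 2 * ‖θ - θ'‖ := by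
  simp only [meanDirection, ← Finset.sum_sub_distrib, ← smul_sub, ← stepMean_sub]
  exact norm_sum_smul_le_of_mem_stdSimplex hπ fun x =>
    norm_stepMean_le M μ (norm_tdDirection_sub_le hγ0 hγ1 hφ θ θ' x) x

/-- Both directions have norm at most `G = rmax + 2R`, and `‖θ - θ*‖ ≤ 2R ≤ G`. -/
theorem abs_gradBias_le (hγ0 : 0 ≤ γ) (hγ1 : γ ≤ 1) (hφ : ∀ x, ‖φ x‖ ≤ 1)
    (hr : ∀ s a s', |M.reward s a s'| ≤ rmax) (hπ : π ∈ stdSimplex ℝ S)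
    {θstar θ : EuclideanSpace ℝ (Fin K)} (hθs : ‖θstar‖ ≤ R) (hθ : ‖θ‖ ≤ R)
    (x : S) (b : A) (y : S) :
    |gradBias M μ γ π φ θstar θ x b y| ≤ 2 * (rmax + 2 * R) ^ 2 := by
  have hr0 : 0 ≤ rmax := (abs_nonneg _).trans (hr x b y)
  have hR0 : 0 ≤ R := (norm_nonneg _).trans hθ
  have h1 : ‖tdDirection M γ φ x b y θ - meanDirection M μ γ π φ θ‖ ≤ 2 * (rmax + 2 * R) := by
    refine (norm_sub_le _ _).trans ?_
    linarith [norm_tdDirection_le hγ0 hγ1 hφ hr hθ x b y,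
      norm_meanDirection_le (μ := μ) hγ0 hγ1 hφ hr hπ hθ]
  have h2 : ‖θ - θstar‖ ≤ rmax + 2 * R := (norm_sub_le _ _).trans (by linarith)
  calc _ ≤ _ := abs_real_inner_le_norm _ _
    _ ≤ (2 * (rmax + 2 * R)) * (rmax + 2 * R) :=
      mul_le_mul h1 h2 (norm_nonneg _) (by positivity)
    _ = _ := by ring

/-- Of the constant `6G`, `2G` comes from changing the test vector and `4G` from the two directions,
each 2-Lipschitz, tested against a vector of norm at most `G`. -/
theorem gradBias_sub_le (hγ0 : 0 ≤ γ) (hγ1 : γ ≤ 1) (hφ : ∀ x, ‖φ x‖ ≤ 1)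
    (hr : ∀ s a s', |M.reward s a s'| ≤ rmax) (hπ : π ∈ stdSimplex ℝ S)
    {θstar θ θ' : EuclideanSpace ℝ (Fin K)} (hθs : ‖θstar‖ ≤ R) (hθ : ‖θ‖ ≤ R)
    (hθ' : ‖θ'‖ ≤ R) (x : S) (b : A) (y : S) :
    gradBias M μ γ π φ θstar θ x b y - gradBias M μ γ π φ θstar θ' x b y ≤
      6 * (rmax + 2 * R) * ‖θ - θ'‖ := by
  have hr0 : 0 ≤ rmax := (abs_nonneg _).trans (hr x b y)
  set g := tdDirection M γ φ x b y θ
  set g' := tdDirection M γ φ x b y θ'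
  set m := meanDirection M μ γ π φ θ
  set m' := meanDirection M μ γ π φ θ'
  have h0 : gradBias M μ γ π φ θstar θ x b y - gradBias M μ γ π φ θstar θ' x b y =
      ⟪g - m, θ - θ'⟫ + ⟪(g - g') - (m - m'), θ' - θstar⟫ := by
    simp only [gradBias, inner_sub_left, inner_sub_right, g, g', m, m']
    ring
  have h1 : ‖g - m‖ ≤ 2 * (rmax + 2 * R) := by
    refine (norm_sub_le _ _).trans ?_
    linarith [norm_tdDirection_le hγ0 hγ1 hφ hr hθ x b y,
      norm_meanDirection_le (μ := μ) hγ0 hγ1 hφ hr hπ hθ]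
  have h2 : ‖(g - g') - (m - m')‖ ≤ 4 * ‖θ - θ'‖ := by
    refine (norm_sub_le _ _).trans ?_
    linarith [norm_tdDirection_sub_le (M := M) hγ0 hγ1 hφ θ θ' x b y,
      norm_meanDirection_sub_le (M := M) (μ := μ) hγ0 hγ1 hφ hπ θ θ']
  have h3 : ‖θ' - θstar‖ ≤ rmax + 2 * R := (norm_sub_le _ _).trans (by linarith)
  have h4 := mul_le_mul_of_nonneg_right h1 (norm_nonneg (θ - θ'))
  have h5 := mul_le_mul h2 h3 (norm_nonneg _) (by positivity)
  rw [h0]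
  linarith [real_inner_le_norm (g - m) (θ - θ'),
    real_inner_le_norm ((g - g') - (m - m')) (θ' - θstar)]

theorem sum_stepMean_gradBias (hπ : π ∈ stdSimplex ℝ S) (θstar θ : EuclideanSpace ℝ (Fin K)) :
    ∑ x, π x * stepMean M μ (gradBias M μ γ π φ θstar θ x) x = 0 := by
  have h1 : ∀ x, stepMean M μ (gradBias M μ γ π φ θstar θ x) x =
      ⟪stepMean M μ (fun b y => tdDirection M γ φ x b y θ) x - meanDirection M μ γ π φ θ,
        θ - θstar⟫ := by
    intro x
    have h2 := stepMean_sub M μ (fun b y => tdDirection M γ φ x b y θ)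
      (fun _ _ => meanDirection M μ γ π φ θ) x
    rw [stepMean_const] at h2
    rw [← h2, ← stepMean_inner]
    rfl
  simp only [h1, ← real_inner_smul_left, ← sum_inner, smul_sub, Finset.sum_sub_distrib,
    ← Finset.sum_smul, hπ.2, one_smul]
  rw [← meanDirection, sub_self, inner_zero_left]

end Bounds

end Direction

/-! ### Convexity of the errors, for the averaged iterate. -/

theorem value_sub_avgIterate {S Ω : Type*} {K : ℕ} (φ : S → EuclideanSpace ℝ (Fin K))
    (θstar : EuclideanSpace ℝ (Fin K)) (θ : ℕ → Ω → EuclideanSpace ℝ (Fin K)) {T : ℕ}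
    (hT : 1 ≤ T) (ω : Ω) (x : S) :
    (value φ θstar - value φ (avgIterate θ T ω)) x =
      (1 / (T : ℝ)) * ∑ t ∈ Finset.range T, (value φ θstar - value φ (θ t ω)) x := by
  have hT0 : (T : ℝ) ≠ 0 := by positivity
  simp only [Pi.sub_apply, Finset.sum_sub_distrib, Finset.sum_const, Finset.card_range,
    nsmul_eq_mul, mul_sub, value, avgIterate, real_inner_smul_left, sum_inner]
  field_simp

theorem sq_average_le (T : ℕ) (f : ℕ → ℝ) :
    ((1 / (T : ℝ)) * ∑ t ∈ Finset.range T, f t) ^ 2 ≤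
      (1 / (T : ℝ)) * ∑ t ∈ Finset.range T, f t ^ 2 := by
  rcases Nat.eq_zero_or_pos T with rfl | hT
  · simp
  have h := sq_sum_le_card_mul_sum_sq (s := Finset.range T) (f := f)
  rw [Finset.card_range] at h
  have hT0 : (0 : ℝ) < T := by positivity
  calc _ = (1 / (T : ℝ)) ^ 2 * (∑ t ∈ Finset.range T, f t) ^ 2 := by ring
    _ ≤ (1 / (T : ℝ)) ^ 2 * (T * ∑ t ∈ Finset.range T, f t ^ 2) := by gcongr
    _ = _ := by field_simp

section Average

variable {S : Type*} [Fintype S] {K : ℕ}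

theorem errD_avgIterate_le {Ω : Type*} {π : S → ℝ} (hπ : ∀ x, 0 ≤ π x)
    (φ : S → EuclideanSpace ℝ (Fin K)) (θstar : EuclideanSpace ℝ (Fin K))
    (θ : ℕ → Ω → EuclideanSpace ℝ (Fin K)) {T : ℕ} (hT : 1 ≤ T) (ω : Ω) :
    errD π φ θstar (avgIterate θ T ω) ≤
      (1 / (T : ℝ)) * ∑ t ∈ Finset.range T, errD π φ θstar (θ t ω) := by
  simp only [errD, sqNormD, value_sub_avgIterate φ θstar θ hT]
  rw [Finset.sum_comm, Finset.mul_sum]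
  refine Finset.sum_le_sum fun x _ => ?_
  rw [← Finset.mul_sum, mul_left_comm]
  exact mul_le_mul_of_nonneg_left (sq_average_le T _) (hπ x)

theorem errDir_avgIterate_le {Ω : Type*} {P : Matrix S S ℝ} (hP : ∀ x y, 0 ≤ P x y)
    {π : S → ℝ} (hπ : ∀ x, 0 ≤ π x)
    (φ : S → EuclideanSpace ℝ (Fin K)) (θstar : EuclideanSpace ℝ (Fin K))
    (θ : ℕ → Ω → EuclideanSpace ℝ (Fin K)) {T : ℕ} (hT : 1 ≤ T) (ω : Ω) :
    errDir P π φ θstar (avgIterate θ T ω) ≤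
      (1 / (T : ℝ)) * ∑ t ∈ Finset.range T, errDir P π φ θstar (θ t ω) := by
  have hswap : ∀ d : ℕ → S → S → ℝ,
      (1 / (T : ℝ)) * ∑ t ∈ Finset.range T, (1 / 2) * ∑ x, ∑ y, π x * P x y * d t x y ^ 2 =
        (1 / 2) * ∑ x, ∑ y, π x * P x y *
          ((1 / (T : ℝ)) * ∑ t ∈ Finset.range T, d t x y ^ 2) := by
    intro d
    simp only [Finset.mul_sum]
    rw [Finset.sum_comm]
    refine Finset.sum_congr rfl fun x _ => ?_
    rw [Finset.sum_comm]
    exact Finset.sum_congr rfl fun y _ => Finset.sum_congr rfl fun t _ => by ring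
  simp only [errDir, sqNormDir, value_sub_avgIterate φ θstar θ hT]
  rw [hswap fun t x y => (value φ θstar - value φ (θ t ω)) y - (value φ θstar - value φ (θ t ω)) x]
  refine mul_le_mul_of_nonneg_left (Finset.sum_le_sum fun x _ => Finset.sum_le_sum fun y _ => ?_)
    (by norm_num)
  rw [← mul_sub, ← Finset.sum_sub_distrib]
  exact mul_le_mul_of_nonneg_left (sq_average_le T _) (mul_nonneg (hπ x) (hP x y))

theorem sqNormD_nonneg {π : S → ℝ} (hπ : ∀ x, 0 ≤ π x) (V : S → ℝ) : 0 ≤ sqNormD π V :=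
  Finset.sum_nonneg fun x _ => mul_nonneg (hπ x) (sq_nonneg _)

theorem sqNormDir_nonneg {P : Matrix S S ℝ} (hP : ∀ x y, 0 ≤ P x y) {π : S → ℝ}
    (hπ : ∀ x, 0 ≤ π x) (V : S → ℝ) : 0 ≤ sqNormDir P π V :=
  mul_nonneg (by norm_num) (Finset.sum_nonneg fun x _ => Finset.sum_nonneg fun y _ =>
    mul_nonneg (mul_nonneg (hπ x) (hP x y)) (sq_nonneg _))

end Average

theorem transMatrix_nonneg {S A : Type*} [Fintype S] [Fintype A] (M : MDP S A) (μ : Policy S A)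
    (x y : S) : 0 ≤ transMatrix M μ x y :=
  Finset.sum_nonneg fun _ _ => mul_nonneg (μ.prob_nonneg _ _) (M.trans_nonneg _ _ _)

theorem mixTime_spec {m ρ ε : ℝ} (hm : 0 < m) (hρ0 : 0 < ρ) (hρ1 : ρ < 1) (hε : 0 < ε) :
    m * ρ ^ mixTime m ρ ε ≤ ε := by
  obtain ⟨n, hn⟩ := exists_pow_lt_of_lt_one (div_pos hε hm) hρ1
  -- Without a member, `sInf` would be the default value 0 and carry no information.
  have hne : {t : ℕ | 1 ≤ t ∧ m * ρ ^ t ≤ ε}.Nonempty := by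
    refine ⟨n + 1, Nat.le_add_left 1 n, ?_⟩
    have h1 : ρ ^ (n + 1) ≤ ρ ^ n := pow_le_pow_of_le_one hρ0.le hρ1.le (Nat.le_succ n)
    have h2 := (lt_div_iff₀' hm).1 hn
    nlinarith
  exact (Nat.sInf_mem hne).2

/-! ### Pathwise estimates for projected TD(0). -/

section Iterates

variable {S A Ω : Type*} [Fintype S] {K : ℕ} {M : MDP S A} {γ : ℝ}
  {φ : S → EuclideanSpace ℝ (Fin K)} {Θ : Set (EuclideanSpace ℝ (Fin K))} {α : ℕ → ℝ}
  {s : ℕ → Ω → S} {a : ℕ → Ω → A} {θ₀ : EuclideanSpace ℝ (Fin K)}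
  {θ : ℕ → Ω → EuclideanSpace ℝ (Fin K)} {rmax R ε : ℝ} {T : ℕ}

theorem IsProjectedTD.mem (h : IsProjectedTD M γ φ Θ α s a θ₀ θ) (hθ₀ : θ₀ ∈ Θ) (t : ℕ)
    (ω : Ω) : θ t ω ∈ Θ := by
  cases t with
  | zero => rw [h.1]; exact hθ₀
  | succ t => exact (h.2 t ω).1

theorem IsProjectedTD.dependsOnHistory (h : IsProjectedTD M γ φ Θ α s a θ₀ θ)
    (hΘ : Convex ℝ Θ) (t : ℕ) : DependsOnHistory s a t (θ t) := by
  induction t with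
  | zero => intro ω ω' _ _; rw [h.1, h.1]
  | succ t ih =>
    intro ω ω' hs ha
    have h1 := h.2 t ω
    rw [hs t (Nat.le_succ t), hs (t + 1) le_rfl, ha t (Nat.lt_succ_self t),
      ih.mono (Nat.le_succ t) ω ω' hs ha] at h1
    exact h1.unique hΘ (h.2 t ω')

theorem IsProjectedTD.norm_step_le (h : IsProjectedTD M γ φ Θ α s a θ₀ θ) (hΘ : Convex ℝ Θ)
    (hθ₀ : θ₀ ∈ Θ) (hR : ∀ θ ∈ Θ, ‖θ‖ ≤ R) (hγ0 : 0 ≤ γ) (hγ1 : γ ≤ 1)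
    (hφ : ∀ x, ‖φ x‖ ≤ 1) (hr : ∀ s a s', |M.reward s a s'| ≤ rmax) {t : ℕ} (hα : α t = ε)
    (hε : 0 ≤ ε) (ω : Ω) : ‖θ (t + 1) ω - θ t ω‖ ≤ ε * (rmax + 2 * R) := by
  refine ((h.2 t ω).norm_sub_le hΘ (h.mem hθ₀ t ω)).trans ?_
  rw [add_sub_cancel_left, norm_smul, hα, Real.norm_of_nonneg hε]
  exact mul_le_mul_of_nonneg_left
    (norm_tdDirection_le hγ0 hγ1 hφ hr (hR _ (h.mem hθ₀ t ω)) _ _ _) hε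

theorem IsProjectedTD.norm_sub_le (h : IsProjectedTD M γ φ Θ α s a θ₀ θ) (hΘ : Convex ℝ Θ)
    (hθ₀ : θ₀ ∈ Θ) (hR : ∀ θ ∈ Θ, ‖θ‖ ≤ R) (hγ0 : 0 ≤ γ) (hγ1 : γ ≤ 1)
    (hφ : ∀ x, ‖φ x‖ ≤ 1) (hr : ∀ s a s', |M.reward s a s'| ≤ rmax)
    (hα : ∀ t < T, α t = ε) (hε : 0 ≤ ε) (n k : ℕ) (hk : n + k ≤ T) (ω : Ω) :
    ‖θ (n + k) ω - θ n ω‖ ≤ k * (ε * (rmax + 2 * R)) := by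
  induction k with
  | zero => simp
  | succ k ih =>
    have h1 := h.norm_step_le hΘ hθ₀ hR hγ0 hγ1 hφ hr (hα (n + k) (by omega)) hε ω
    have h2 := norm_sub_le_norm_sub_add_norm_sub (θ (n + k + 1) ω) (θ (n + k) ω) (θ n ω)
    have h3 := ih (by omega)
    push_cast
    rw [← add_assoc]
    linarith

/-- One step of the projected iteration, with the bias of its direction split off. -/
theorem IsProjectedTD.step_le [Fintype A] (h : IsProjectedTD M γ φ Θ α s a θ₀ θ)
    (hΘ : Convex ℝ Θ) (hθ₀ : θ₀ ∈ Θ) (hR : ∀ θ ∈ Θ, ‖θ‖ ≤ R) (hγ0 : 0 ≤ γ) (hγ1 : γ ≤ 1)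
    (hφ : ∀ x, ‖φ x‖ ≤ 1) (hr : ∀ s a s', |M.reward s a s'| ≤ rmax) {μ : Policy S A} {π : S → ℝ}
    (hπ : IsStationaryDist (transMatrix M μ) π) {θstar : EuclideanSpace ℝ (Fin K)}
    (hs : IsTDFixedPoint M μ γ π φ θstar) (hθs : θstar ∈ Θ) {t : ℕ} (hα : α t = ε) (ω : Ω) :
    2 * ε * ((1 - γ) * errD π φ θstar (θ t ω) +
        γ * errDir (transMatrix M μ) π φ θstar (θ t ω)) ≤
      ‖θ t ω - θstar‖ ^ 2 - ‖θ (t + 1) ω - θstar‖ ^ 2 + ε ^ 2 * (rmax + 2 * R) ^ 2 +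
        2 * ε * gradBias M μ γ π φ θstar (θ t ω) (s t ω) (a t ω) (s (t + 1) ω) := by
  set g := tdDirection M γ φ (s t ω) (a t ω) (s (t + 1) ω) (θ t ω) with hg
  -- As `θ*` lies in `Θ`, projecting does not increase the distance to it.
  have h1 := (h.2 t ω).norm_sub_le hΘ hθs
  rw [hα, ← hg] at h1
  have h2 : ‖g‖ ≤ rmax + 2 * R :=
    norm_tdDirection_le hγ0 hγ1 hφ hr (hR _ (h.mem hθ₀ t ω)) _ _ _
  have h3 : ‖θ t ω + ε • g - θstar‖ ^ 2 =
      ‖θ t ω - θstar‖ ^ 2 + 2 * ε * ⟪g, θ t ω - θstar⟫ + ε ^ 2 * ‖g‖ ^ 2 := by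
    rw [add_sub_right_comm, norm_add_sq_real, real_inner_smul_right, norm_smul, mul_pow,
      Real.norm_eq_abs, sq_abs, real_inner_comm]
    ring
  have h4 := pow_le_pow_left₀ (norm_nonneg _) h1 2
  have h5 := mul_le_mul_of_nonneg_left (pow_le_pow_left₀ (norm_nonneg _) h2 2) (sq_nonneg ε)
  rw [← inner_meanDirection_eq_err hπ hs, gradBias, ← hg, inner_sub_left, ← neg_sub (θ t ω),
    inner_neg_right]
  linarith

end Iterates

/-! ### The expected bias under Markovian sampling. -/

section Bias

variable {S A : Type*} [Fintype S] [DecidableEq S] [Fintype A]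
  [MeasurableSpace S] [MeasurableSingletonClass S]
  [MeasurableSpace A] [MeasurableSingletonClass A]
  {Ω : Type*} [MeasurableSpace Ω] {ℙ : Measure Ω} [IsProbabilityMeasure ℙ]
  {K : ℕ} {M : MDP S A} {μ : Policy S A} {π : S → ℝ} {s : ℕ → Ω → S} {a : ℕ → Ω → A}

theorem IsTrajectory.integral_mono (h : IsTrajectory M μ π ℙ s a) {n : ℕ} {F G : Ω → ℝ}
    (hF : DependsOnHistory s a n F) (hG : DependsOnHistory s a n G) (hFG : ∀ ω, F ω ≤ G ω) :
    ∫ ω, F ω ∂ℙ ≤ ∫ ω, G ω ∂ℙ :=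
  MeasureTheory.integral_mono (h.integrable hF) (h.integrable hG) hFG

/-- The mean bias at an iterate that lies `k` steps back. -/
theorem IsTrajectory.integral_delayed_le (h : IsTrajectory M μ π ℙ s a) {m ρ : ℝ}
    (hmix : UniformlyMixing (transMatrix M μ) π m ρ) {E : Type*} (ξ : E → S → A → S → ℝ) {n : ℕ}
    {X : Ω → E} (hX : DependsOnHistory s a n X) (hmean : ∀ ω,
      ∑ x, π x * stepMean M μ (ξ (X ω) x) x = 0) {C : ℝ} (hC0 : 0 ≤ C)
    (hC : ∀ ω x b y, |ξ (X ω) x b y| ≤ C) (k : ℕ) :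
    ∫ ω, ξ (X ω) (s (n + k) ω) (a (n + k) ω) (s (n + k + 1) ω) ∂ℙ ≤ 2 * C * (m * ρ ^ k) := by
  have hXk := hX.mono (Nat.le_add_right n k)
  rw [h.integral_step (n + k) (fun ω => ξ (X ω) (s (n + k) ω))
      ((hXk.prodMk (DependsOnHistory.state le_rfl)).comp fun p => ξ p.1 p.2),
    h.integral_state_add n k (fun ω x => stepMean M μ (ξ (X ω) x) x)
      (hX.comp fun v x => stepMean M μ (ξ v x) x)]
  have hle : ∀ ω, ∑ x, (transMatrix M μ ^ k) (s n ω) x * stepMean M μ (ξ (X ω) x) x ≤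
      2 * C * (m * ρ ^ k) := by
    intro ω
    -- The `π`-mean vanishes by `hmean`, so it can be subtracted for free, leaving the distance of
    -- `P^k` from `π`.
    have h1 := abs_sum_sub_mul_le_tvDist ((transMatrix M μ ^ k) (s n ω)) π
      (fun x => stepMean M μ (ξ (X ω) x) x) (C := C) fun x => by
        rw [← Real.norm_eq_abs]
        exact norm_stepMean_le M μ (hC ω x) x
    simp only [sub_mul, Finset.sum_sub_distrib, hmean, sub_zero] at h1
    exact (le_abs_self _).trans (h1.trans
      (mul_le_mul_of_nonneg_left (hmix k _) (mul_nonneg zero_le_two hC0)))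
  have h2 := h.integral_mono (n := n)
    ((hX.prodMk (DependsOnHistory.state le_rfl)).comp fun p : E × S =>
      ∑ x, (transMatrix M μ ^ k) p.2 x * stepMean M μ (ξ p.1 x) x)
    (G := fun _ => 2 * C * (m * ρ ^ k)) (fun _ _ _ _ => rfl) hle
  simpa using h2

theorem IsTrajectory.integral_stationary_step (h : IsTrajectory M μ π ℙ s a)
    (hπ : IsStationaryDist (transMatrix M μ) π) (t : ℕ) (f : S → A → S → ℝ) :
    ∫ ω, f (s t ω) (a t ω) (s (t + 1) ω) ∂ℙ = ∑ x, π x * stepMean M μ (f x) x := by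
  rw [h.integral_step t (fun ω => f (s t ω)) ((DependsOnHistory.state le_rfl).comp f),
    h.integral_stationary hπ t fun x => stepMean M μ (f x) x]

theorem IsTrajectory.integral_gradBias_le (htraj : IsTrajectory M μ π ℙ s a) {m ρ : ℝ}
    (hmix : UniformlyMixing (transMatrix M μ) π m ρ)
    (hπ : IsStationaryDist (transMatrix M μ) π) {γ : ℝ} (hγ0 : 0 ≤ γ) (hγ1 : γ ≤ 1)
    {φ : S → EuclideanSpace ℝ (Fin K)} (hφ : ∀ x, ‖φ x‖ ≤ 1) {rmax R ε : ℝ}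
    (hr : ∀ s a s', |M.reward s a s'| ≤ rmax)
    {Θ : Set (EuclideanSpace ℝ (Fin K))} (hΘ : Convex ℝ Θ) (hR : ∀ θ ∈ Θ, ‖θ‖ ≤ R)
    {θstar θ₀ : EuclideanSpace ℝ (Fin K)} (hθs : θstar ∈ Θ) (hθ₀ : θ₀ ∈ Θ) {α : ℕ → ℝ} {T : ℕ}
    (hα : ∀ t < T, α t = ε) (hε : 0 ≤ ε) {θ : ℕ → Ω → EuclideanSpace ℝ (Fin K)}
    (h : IsProjectedTD M γ φ Θ α s a θ₀ θ) {τ : ℕ} (hτ : m * ρ ^ τ ≤ ε) {t : ℕ} (ht : t < T) :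
    ∫ ω, gradBias M μ γ π φ θstar (θ t ω) (s t ω) (a t ω) (s (t + 1) ω) ∂ℙ ≤
      (rmax + 2 * R) ^ 2 * (4 + 6 * τ) * ε := by
  have hrR : 0 ≤ rmax + 2 * R := by
    obtain ⟨ω⟩ := nonempty_of_isProbabilityMeasure ℙ
    linarith [(abs_nonneg _).trans (hr (s 0 ω) (a 0 ω) (s 0 ω)), (norm_nonneg _).trans (hR _ hθs)]
  have hdep : ∀ n ≤ t, DependsOnHistory s a (t + 1) fun ω =>
      gradBias M μ γ π φ θstar (θ n ω) (s t ω) (a t ω) (s (t + 1) ω) := fun n hn =>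
    ((((h.dependsOnHistory hΘ n).mono (by omega)).prodMk
      (DependsOnHistory.state (Nat.le_succ t))).prodMk
      ((DependsOnHistory.action (Nat.lt_succ_self t)).prodMk (DependsOnHistory.state le_rfl))).comp
      fun p => gradBias M μ γ π φ θstar p.1.1 p.1.2 p.2.1 p.2.2
  have hlip : ∀ n k, n + k = t →
      ∫ ω, gradBias M μ γ π φ θstar (θ t ω) (s t ω) (a t ω) (s (t + 1) ω) ∂ℙ ≤
        ∫ ω, gradBias M μ γ π φ θstar (θ n ω) (s t ω) (a t ω) (s (t + 1) ω) ∂ℙ +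
          6 * (rmax + 2 * R) * (k * (ε * (rmax + 2 * R))) := by
    intro n k hnk
    have h1 := htraj.integral_mono (hdep t le_rfl)
      ((hdep n (by omega)).comp (· + 6 * (rmax + 2 * R) * (k * (ε * (rmax + 2 * R)))))
      fun ω => by
        have h2 := gradBias_sub_le (μ := μ) hγ0 hγ1 hφ hr hπ.1 (hR _ hθs)
          (hR _ (h.mem hθ₀ t ω)) (hR _ (h.mem hθ₀ n ω)) (s t ω) (a t ω) (s (t + 1) ω)
        have h3 := h.norm_sub_le hΘ hθ₀ hR hγ0 hγ1 hφ hr hα hε n k (by omega) ω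
        rw [hnk] at h3
        have h4 := mul_le_mul_of_nonneg_left h3 (mul_nonneg (by norm_num : (0 : ℝ) ≤ 6) hrR)
        linarith
    rwa [integral_add (htraj.integrable (hdep n (by omega))) (integrable_const _),
      integral_const, probReal_univ, one_smul] at h1
  have hG : 0 ≤ (rmax + 2 * R) ^ 2 * ε := by positivity
  -- Late times go back `τ` steps and use mixing. Early times go back to the deterministic `θ₀`,
  -- where stationarity of `s t` makes the mean bias exactly zero.
  rcases le_or_gt τ t with hle | hlt
  · have h1 := hlip (t - τ) τ (by omega)
    have h2 := htraj.integral_delayed_le hmix (gradBias M μ γ π φ θstar)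
      (h.dependsOnHistory hΘ (t - τ)) (fun ω => sum_stepMean_gradBias hπ.1 _ _)
      (C := 2 * (rmax + 2 * R) ^ 2) (by positivity)
      (fun ω x b y => abs_gradBias_le hγ0 hγ1 hφ hr hπ.1 (hR _ hθs) (hR _ (h.mem hθ₀ _ ω)) x b y) τ
    rw [Nat.sub_add_cancel hle] at h2
    have h3 := mul_le_mul_of_nonneg_left hτ (by positivity : 0 ≤ 2 * (2 * (rmax + 2 * R) ^ 2))
    linarith
  · have h1 := hlip 0 t (zero_add t)
    simp only [h.1] at h1
    rw [htraj.integral_stationary_step hπ t, sum_stepMean_gradBias hπ.1] at h1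
    have h2 : (t : ℝ) ≤ τ := by exact_mod_cast hlt.le
    have h3 := mul_le_mul_of_nonneg_left h2 hG
    linarith

end Bias

/-! ### Summation over time and the averaged iterate. -/

section ErrorBound

variable {S A : Type*} [Fintype S] [DecidableEq S] [Fintype A]
  [MeasurableSpace S] [MeasurableSingletonClass S]
  [MeasurableSpace A] [MeasurableSingletonClass A]
  {Ω : Type*} [MeasurableSpace Ω] {ℙ : Measure Ω} [IsProbabilityMeasure ℙ]
  {K : ℕ} {M : MDP S A} {μ : Policy S A} {π : S → ℝ} {s : ℕ → Ω → S} {a : ℕ → Ω → A}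

/-- The squared distances to `θ*` telescope; keeping the last one in the bound lets the induction on
`N` close. -/
theorem IsTrajectory.sum_integral_err_le (htraj : IsTrajectory M μ π ℙ s a) {m ρ : ℝ}
    (hmix : UniformlyMixing (transMatrix M μ) π m ρ)
    (hπ : IsStationaryDist (transMatrix M μ) π) {γ : ℝ} (hγ0 : 0 ≤ γ) (hγ1 : γ ≤ 1)
    {φ : S → EuclideanSpace ℝ (Fin K)} (hφ : ∀ x, ‖φ x‖ ≤ 1) {rmax R ε : ℝ}
    (hr : ∀ s a s', |M.reward s a s'| ≤ rmax)
    {Θ : Set (EuclideanSpace ℝ (Fin K))} (hΘ : Convex ℝ Θ) (hR : ∀ θ ∈ Θ, ‖θ‖ ≤ R)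
    {θstar θ₀ : EuclideanSpace ℝ (Fin K)} (hs : IsTDFixedPoint M μ γ π φ θstar)
    (hθs : θstar ∈ Θ) (hθ₀ : θ₀ ∈ Θ) {α : ℕ → ℝ} {T : ℕ}
    (hα : ∀ t < T, α t = ε) (hε : 0 ≤ ε) {θ : ℕ → Ω → EuclideanSpace ℝ (Fin K)}
    (h : IsProjectedTD M γ φ Θ α s a θ₀ θ) {τ : ℕ} (hτ : m * ρ ^ τ ≤ ε) {N : ℕ} (hN : N ≤ T) :
    2 * ε * ∑ t ∈ Finset.range N, ∫ ω, ((1 - γ) * errD π φ θstar (θ t ω) +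
        γ * errDir (transMatrix M μ) π φ θstar (θ t ω)) ∂ℙ ≤
      ‖θstar - θ₀‖ ^ 2 - ∫ ω, ‖θ N ω - θstar‖ ^ 2 ∂ℙ +
        N * (ε ^ 2 * (rmax + 2 * R) ^ 2 * (9 + 12 * τ)) := by
  induction N with
  | zero => simp [h.1, norm_sub_rev]
  | succ t ih =>
    have ih := ih (by omega)
    have hb := htraj.integral_gradBias_le hmix hπ hγ0 hγ1 hφ hr hΘ hR hθs hθ₀ hα hε h hτ
      (show t < T by omega)
    have hθt := (h.dependsOnHistory hΘ t).mono (Nat.le_succ t)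
    have hbias : DependsOnHistory s a (t + 1) fun ω =>
        gradBias M μ γ π φ θstar (θ t ω) (s t ω) (a t ω) (s (t + 1) ω) :=
      ((hθt.prodMk (DependsOnHistory.state (Nat.le_succ t))).prodMk
        ((DependsOnHistory.action (Nat.lt_succ_self t)).prodMk
          (DependsOnHistory.state le_rfl))).comp
        fun p => gradBias M μ γ π φ θstar p.1.1 p.1.2 p.2.1 p.2.2
    have hi1 := htraj.integrable (hθt.comp fun v => ‖v - θstar‖ ^ 2)
    have hi2 := htraj.integrable
      ((h.dependsOnHistory hΘ (t + 1)).comp fun v => ‖v - θstar‖ ^ 2)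
    have hi3 := htraj.integrable hbias
    have hi4 := htraj.integrable (hθt.comp fun v => 2 * ε * ((1 - γ) * errD π φ θstar v +
        γ * errDir (transMatrix M μ) π φ θstar v))
    have h1 := MeasureTheory.integral_mono hi4
      (((hi1.sub hi2).add (integrable_const (ε ^ 2 * (rmax + 2 * R) ^ 2))).add
        (hi3.const_mul (2 * ε)))
      fun ω => h.step_le hΘ hθ₀ hR hγ0 hγ1 hφ hr hπ hs hθs (hα t (by omega)) ω
    rw [integral_add' ((hi1.sub hi2).add (integrable_const _)) (hi3.const_mul _),
      integral_add' (hi1.sub hi2) (integrable_const _), integral_sub' hi1 hi2,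
      integral_const, probReal_univ, one_smul] at h1
    simp only [integral_const_mul] at h1
    have h2 := mul_le_mul_of_nonneg_left hb (mul_nonneg zero_le_two hε)
    rw [Finset.sum_range_succ]
    push_cast
    linarith

theorem IsTrajectory.integral_err_avgIterate_le (htraj : IsTrajectory M μ π ℙ s a) {m ρ : ℝ}
    (hm : 0 < m) (hρ0 : 0 < ρ) (hρ1 : ρ < 1)
    (hmix : UniformlyMixing (transMatrix M μ) π m ρ)
    (hπ : IsStationaryDist (transMatrix M μ) π) {γ : ℝ} (hγ0 : 0 ≤ γ) (hγ1 : γ ≤ 1)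
    {φ : S → EuclideanSpace ℝ (Fin K)} (hφ : ∀ x, ‖φ x‖ ≤ 1) {rmax R : ℝ}
    (hr : ∀ s a s', |M.reward s a s'| ≤ rmax)
    {Θ : Set (EuclideanSpace ℝ (Fin K))} (hΘ : Convex ℝ Θ) (hR : ∀ θ ∈ Θ, ‖θ‖ ≤ R)
    {θstar θ₀ : EuclideanSpace ℝ (Fin K)} (hs : IsTDFixedPoint M μ γ π φ θstar)
    (hθs : θstar ∈ Θ) (hθ₀ : θ₀ ∈ Θ) {α : ℕ → ℝ} {T : ℕ} (hT : 1 ≤ T)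
    (hα : ∀ t < T, α t = 1 / √(T : ℝ)) {θ : ℕ → Ω → EuclideanSpace ℝ (Fin K)}
    (h : IsProjectedTD M γ φ Θ α s a θ₀ θ) :
    Integrable (fun ω => errD π φ θstar (avgIterate θ T ω)) ℙ ∧
    Integrable (fun ω => errDir (transMatrix M μ) π φ θstar (avgIterate θ T ω)) ℙ ∧
    ∫ ω, ((1 - γ) * errD π φ θstar (avgIterate θ T ω) +
        γ * errDir (transMatrix M μ) π φ θstar (avgIterate θ T ω)) ∂ℙ ≤
      (‖θstar - θ₀‖ ^ 2 + (rmax + 2 * R) ^ 2 * (9 + 12 * (mixTime m ρ (1 / √(T : ℝ)) : ℝ))) /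
        (2 * √(T : ℝ)) := by
  have havg : DependsOnHistory s a T (avgIterate θ T) := fun ω ω' hs' ha' =>
    congrArg ((1 / (T : ℝ)) • ·) <| Finset.sum_congr rfl fun t ht =>
      (h.dependsOnHistory hΘ t).mono (Finset.mem_range.1 ht).le ω ω' hs' ha'
  have hiD := htraj.integrable (havg.comp (errD π φ θstar))
  have hiDir := htraj.integrable (havg.comp (errDir (transMatrix M μ) π φ θstar))
  refine ⟨hiD, hiDir, ?_⟩
  set err : EuclideanSpace ℝ (Fin K) → ℝ := fun v =>
    (1 - γ) * errD π φ θstar v + γ * errDir (transMatrix M μ) π φ θstar v with herr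
  have hsT : 0 < √(T : ℝ) := Real.sqrt_pos.2 (by positivity)
  have hε : 0 < 1 / √(T : ℝ) := one_div_pos.2 hsT
  have hsum := htraj.sum_integral_err_le hmix hπ hγ0 hγ1 hφ hr hΘ hR hs hθs hθ₀ hα hε.le h
    (mixTime_spec hm hρ0 hρ1 hε) le_rfl
  have hierr : ∀ t ∈ Finset.range T, Integrable (fun ω => err (θ t ω)) ℙ := fun t _ =>
    htraj.integrable ((h.dependsOnHistory hΘ t).comp err)
  have hjensen : ∀ ω, err (avgIterate θ T ω) ≤
      (1 / (T : ℝ)) * ∑ t ∈ Finset.range T, err (θ t ω) := by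
    intro ω
    have h1 := mul_le_mul_of_nonneg_left (errD_avgIterate_le hπ.1.1 φ θstar θ hT ω)
      (sub_nonneg.2 hγ1)
    have h2 := mul_le_mul_of_nonneg_left
      (errDir_avgIterate_le (transMatrix_nonneg M μ) hπ.1.1 φ θstar θ hT ω) hγ0
    simp only [herr, Finset.sum_add_distrib, ← Finset.mul_sum]
    linarith
  have hint := MeasureTheory.integral_mono (htraj.integrable (havg.comp err))
    ((integrable_finsetSum _ hierr).const_mul (1 / (T : ℝ))) hjensen
  rw [integral_const_mul, integral_finsetSum _ hierr] at hint
  refine hint.trans ?_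
  have hnn : 0 ≤ ∫ ω, ‖θ T ω - θstar‖ ^ 2 ∂ℙ := integral_nonneg fun ω => sq_nonneg _
  have hTs : (T : ℝ) = √(T : ℝ) ^ 2 := (Real.sq_sqrt (Nat.cast_nonneg T)).symm
  set X := ∑ t ∈ Finset.range T, ∫ ω, err (θ t ω) ∂ℙ with hX
  set G := (rmax + 2 * R) ^ 2 * (9 + 12 * (mixTime m ρ (1 / √(T : ℝ)) : ℝ)) with hG
  -- The step size is chosen so that `T ε² = 1`.
  have h1 : (T : ℝ) * ((1 / √(T : ℝ)) ^ 2 * (rmax + 2 * R) ^ 2 *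
      (9 + 12 * (mixTime m ρ (1 / √(T : ℝ)) : ℝ))) = G := by
    rw [mul_assoc (_ ^ 2), ← hG]
    nth_rw 1 [hTs]
    field_simp
  have h2 : 2 * (1 / √(T : ℝ)) * X ≤ ‖θstar - θ₀‖ ^ 2 + G := by
    rw [h1] at hsum
    linarith
  have h3 : 1 / (T : ℝ) * X = 2 * (1 / √(T : ℝ)) * X / (2 * √(T : ℝ)) := by
    nth_rw 1 [hTs]
    field_simp
  rw [h3]
  gcongr

end ErrorBound

end TDLearning

/-! ### The theorem. -/

theorem corollary2
    {S A : Type*} [Fintype S] [DecidableEq S] [Fintype A]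
    [MeasurableSpace S] [MeasurableSingletonClass S]
    [MeasurableSpace A] [MeasurableSingletonClass A]
    {Ω : Type*} [MeasurableSpace Ω] (ℙ : Measure Ω) [IsProbabilityMeasure ℙ]
    {K : ℕ}
    -- the decision process, the policy and the stationary distribution of the induced chain
    (M : TDLearning.MDP S A) (μ : TDLearning.Policy S A) (π : S → ℝ)
    (hirr : (TDLearning.transMatrix M μ).IsIrreducible)
    (haper : TDLearning.IsAperiodic (TDLearning.transMatrix M μ))
    (hπ : TDLearning.IsStationaryDist (TDLearning.transMatrix M μ) π)
    (rmax : ℝ) (hrmax : ∀ s a s', |M.reward s a s'| ≤ rmax)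
    -- the features
    (φ : S → EuclideanSpace ℝ (Fin K)) (hφ : TDLearning.GoodFeatures φ)
    -- uniform mixing, and the stationary trajectory
    (m ρ : ℝ) (hm : 0 < m) (hρ0 : 0 < ρ) (hρ1 : ρ < 1)
    (hmix : TDLearning.UniformlyMixing (TDLearning.transMatrix M μ) π m ρ)
    (s : ℕ → Ω → S) (a : ℕ → Ω → A) (htraj : TDLearning.IsTrajectory M μ π ℙ s a)
    -- the constraint set, the starting point and the step sizes
    (Θ : Set (EuclideanSpace ℝ (Fin K))) (hΘ : Convex ℝ Θ)
    (R : ℝ) (hR : ∀ θ ∈ Θ, ‖θ‖ ≤ R)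
    (θ₀ : EuclideanSpace ℝ (Fin K)) (hθ₀ : θ₀ ∈ Θ)
    (T : ℕ) (hT : 1 ≤ T)
    (α : ℕ → ℝ) (hα : ∀ t ≤ T, α t = 1 / √(T : ℝ)) :
    -- the error bound, and its consequence for the Dirichlet seminorm
    (∀ γ : ℝ, 0 < γ → γ < 1 →
      ∀ θstar : EuclideanSpace ℝ (Fin K),
        TDLearning.IsTDFixedPoint M μ γ π φ θstar → θstar ∈ Θ →
      ∀ θ : ℕ → Ω → EuclideanSpace ℝ (Fin K),
        TDLearning.IsProjectedTD M γ φ Θ α s a θ₀ θ →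
      Integrable (fun ω => TDLearning.errD π φ θstar (TDLearning.avgIterate θ T ω)) ℙ ∧
      Integrable (fun ω => TDLearning.errDir (TDLearning.transMatrix M μ) π φ θstar
        (TDLearning.avgIterate θ T ω)) ℙ ∧
      ∫ ω, ((1 - γ) * TDLearning.errD π φ θstar (TDLearning.avgIterate θ T ω) +
          γ * TDLearning.errDir (TDLearning.transMatrix M μ) π φ θstar
            (TDLearning.avgIterate θ T ω)) ∂ℙ
        ≤ (‖θstar - θ₀‖ ^ 2 + (rmax + 2 * R) ^ 2 *
            (9 + 12 * (TDLearning.mixTime m ρ (1 / √(T : ℝ)) : ℝ))) / (2 * √(T : ℝ)) ∧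
      ∫ ω, TDLearning.errDir (TDLearning.transMatrix M μ) π φ θstar
            (TDLearning.avgIterate θ T ω) ∂ℙ
        ≤ (‖θstar - θ₀‖ ^ 2 + (rmax + 2 * R) ^ 2 *
            (9 + 12 * (TDLearning.mixTime m ρ (1 / √(T : ℝ)) : ℝ))) / (2 * γ * √(T : ℝ))) ∧
    -- no blow-up as `γ → 1`: a bound free of `γ`, valid for all `γ` in `[γ₀, 1)`
    (∀ γ₀ : ℝ, 0 < γ₀ → ∀ γ : ℝ, γ₀ ≤ γ → γ < 1 →
      ∀ θstar : EuclideanSpace ℝ (Fin K),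
        TDLearning.IsTDFixedPoint M μ γ π φ θstar → θstar ∈ Θ →
      ∀ θ : ℕ → Ω → EuclideanSpace ℝ (Fin K),
        TDLearning.IsProjectedTD M γ φ Θ α s a θ₀ θ →
      ∫ ω, TDLearning.errDir (TDLearning.transMatrix M μ) π φ θstar
            (TDLearning.avgIterate θ T ω) ∂ℙ
        ≤ (4 * R ^ 2 + (rmax + 2 * R) ^ 2 *
            (9 + 12 * (TDLearning.mixTime m ρ (1 / √(T : ℝ)) : ℝ))) / (2 * γ₀ * √(T : ℝ))) := by
  have hφ1 : ∀ x, ‖φ x‖ ≤ 1 := fun x =>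
    (sq_le_one_iff₀ (norm_nonneg _)).1 (hφ.2 x)
  have hsT : 0 < √(T : ℝ) := Real.sqrt_pos.2 (by positivity)
  have hDir : ∀ v w, 0 ≤ TDLearning.errDir (TDLearning.transMatrix M μ) π φ v w := fun _ _ =>
    TDLearning.sqNormDir_nonneg (TDLearning.transMatrix_nonneg M μ) hπ.1.1 _
  have main : ∀ γ : ℝ, 0 < γ → γ < 1 → ∀ θstar : EuclideanSpace ℝ (Fin K),
      TDLearning.IsTDFixedPoint M μ γ π φ θstar → θstar ∈ Θ →
      ∀ θ : ℕ → Ω → EuclideanSpace ℝ (Fin K), TDLearning.IsProjectedTD M γ φ Θ α s a θ₀ θ → _ :=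
    fun γ hγ0 hγ1 θstar hs hθs θ hθ =>
      htraj.integral_err_avgIterate_le hm hρ0 hρ1 hmix hπ hγ0.le hγ1.le hφ1 hrmax hΘ hR hs hθs hθ₀
        hT (fun t ht => hα t ht.le) hθ
  have hdirichlet : ∀ γ : ℝ, 0 < γ → γ < 1 → ∀ θstar : EuclideanSpace ℝ (Fin K),
      TDLearning.IsTDFixedPoint M μ γ π φ θstar → θstar ∈ Θ →
      ∀ θ : ℕ → Ω → EuclideanSpace ℝ (Fin K), TDLearning.IsProjectedTD M γ φ Θ α s a θ₀ θ →
      ∫ ω, TDLearning.errDir (TDLearning.transMatrix M μ) π φ θstar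
            (TDLearning.avgIterate θ T ω) ∂ℙ
        ≤ (‖θstar - θ₀‖ ^ 2 + (rmax + 2 * R) ^ 2 *
            (9 + 12 * (TDLearning.mixTime m ρ (1 / √(T : ℝ)) : ℝ))) / (2 * γ * √(T : ℝ)) := by
    intro γ hγ0 hγ1 θstar hs hθs θ hθ
    obtain ⟨hiD, hiDir, hle⟩ := main γ hγ0 hγ1 θstar hs hθs θ hθ
    -- The `D`-term is nonnegative and is dropped; dividing by `γ` does the rest.
    have h1 := MeasureTheory.integral_mono (hiDir.const_mul γ)
      ((hiD.const_mul (1 - γ)).add (hiDir.const_mul γ)) fun ω =>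
        le_add_of_nonneg_left (mul_nonneg (sub_nonneg.2 hγ1.le)
          (TDLearning.sqNormD_nonneg hπ.1.1 _))
    rw [integral_const_mul] at h1
    rw [mul_right_comm, ← div_div, le_div_iff₀' hγ0]
    exact h1.trans hle
  refine ⟨fun γ hγ0 hγ1 θstar hs hθs θ hθ => ?_, fun γ₀ hγ₀ γ hγ hγ1 θstar hs hθs θ hθ => ?_⟩
  · obtain ⟨hiD, hiDir, hle⟩ := main γ hγ0 hγ1 θstar hs hθs θ hθ
    exact ⟨hiD, hiDir, hle, hdirichlet γ hγ0 hγ1 θstar hs hθs θ hθ⟩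
  · refine (hdirichlet γ (hγ₀.trans_le hγ) hγ1 θstar hs hθs θ hθ).trans ?_
    -- `θ*` varies with `γ` but stays in the ball of radius `R`, so this removes the last dependence
    -- on `γ` in the numerator.
    have hnorm : ‖θstar - θ₀‖ ^ 2 ≤ 4 * R ^ 2 := by
      have h1 : ‖θstar - θ₀‖ ≤ 2 * R :=
        (norm_sub_le _ _).trans (by linarith [hR _ hθs, hR _ hθ₀])
      calc _ ≤ (2 * R) ^ 2 := pow_le_pow_left₀ (norm_nonneg _) h1 2
        _ = _ := by ring
    gcongr
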